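/- Let $p$ be a prime and let $G$ be a finitely generated free pro-$p$ group, i.e. a pro-$p$ group with elements $x_1,\dots,x_n\in G$ for some $n\ge 0$ such that for every pro-$p$ group $H$ and all $h_1,\dots,h_n\in H$ there is a unique continuous homomorphism $\varphi\colon G\to H$ with $\varphi(x_i)=h_i$ for all $i$. Let $d_G:=\dim_{\mathbb{F}_p}H^1(G,\mathbb{F}_p)$ (continuous cohomology with trivial coefficients), which is the minimal number of topological generators of $G$. Let $N$ be an open normal subgroup of $G$, and let $N_{\mathrm{ab}}$ be the quotient of $N$ by the closure of its commutator subgroup, an abelian pro-$p$ group and hence a $\mathbb{Z}_p$-module. Then, for the action of $G/N$ on $N_{\mathrm{ab}}$ induced by the conjugation of $G$ on $N$, there exists an isomorphism of $\mathbb{Q}_p[G/N]$-modules $$(N_{\mathrm{ab}}\otimes_{\mathbb{Z}_p}\mathbb{Q}_p)\oplus\mathbb{Q}_p[G/N]\;\cong\;\mathbb{Q}_p\oplus\mathbb{Q}_p[G/N]^{\oplus d_G},$$ where $\mathbb{Q}_p$ carries the trivial representation of $G/N$. -/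

import Mathlib

open scoped TensorProduct commutatorElement

universe u

/-! ### Pro-p groups -/

/-- A topological group is a pro-`p` group if it is profinite (compact and totally disconnected)
and all its quotients by open normal subgroups are `p`-groups. -/
class IsProP (p : ℕ) (G : Type*) [Group G] [TopologicalSpace G] [IsTopologicalGroup G] : Prop where
  compact : CompactSpace G
  totallyDisconnected : TotallyDisconnectedSpace G
  isPGroup_quotient : ∀ V : OpenNormalSubgroup G, IsPGroup p (G ⧸ V.toSubgroup)

/-- The pro-`p` group `G` is free on the finite family `x`: for every pro-`p` group `H` and every
family `h` in `H` there is a unique continuous homomorphism `φ : G → H` with `φ (x i) = h i`. -/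
def IsFreeProPOn (p : ℕ) {G : Type u} [Group G] [TopologicalSpace G] [IsTopologicalGroup G]
    {n : ℕ} (x : Fin n → G) : Prop :=
  ∀ (H : Type u) [Group H] [TopologicalSpace H] [IsTopologicalGroup H] [IsProP p H]
    (h : Fin n → H), ∃! φ : G →ₜ* H, ∀ i, φ (x i) = h i

/-! ### The number `d_G` -/

section FirstCohomology

variable (p : ℕ) (G : Type*) [Group G] [TopologicalSpace G]

/-- The continuous inhomogeneous `1`-cocycles `Z¹(G, 𝔽_p)` for the trivial action of `G`. -/
def contCocycles₁ : Submodule (ZMod p) (G → ZMod p) where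
  carrier := {f | Continuous f ∧ ∀ g h, f (g * h) = f g + f h}
  add_mem' := by
    rintro f f' ⟨hf, hf'⟩ ⟨kf, kf'⟩
    refine ⟨hf.add kf, fun g h => ?_⟩
    simp only [Pi.add_apply, hf', kf']
    abel
  zero_mem' := ⟨continuous_const, fun _ _ => by simp⟩
  smul_mem' := by
    rintro c f ⟨hf, hf'⟩
    exact ⟨continuous_const.mul hf, fun g h => by simp [hf', mul_add]⟩

/-- The `1`-coboundaries `B¹(G, 𝔽_p)`, that is, the functions `g ↦ g • a - a` for `a ∈ 𝔽_p`.
As `G` acts trivially, `g • a - a = a - a`. -/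
def contCoboundaries₁ : Submodule (ZMod p) (G → ZMod p) :=
  Submodule.span (ZMod p) (Set.range fun a : ZMod p => fun _ : G => a - a)

/-- The first continuous cohomology `H¹(G, 𝔽_p)` with trivial coefficients. -/
abbrev ContH1 : Type _ :=
  contCocycles₁ p G ⧸ (contCoboundaries₁ p G).comap (contCocycles₁ p G).subtype

/-- `d_G = dim H¹(G, 𝔽_p)`, the minimal number of (topological) generators of `G`. -/
noncomputable def genRank : ℕ := Module.finrank (ZMod p) (ContH1 p G)

end FirstCohomology

/-! ### Subgroups and quotients of pro-p groups -/

section ProP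

variable {p : ℕ} {G : Type*} [Group G] [TopologicalSpace G] [IsTopologicalGroup G]

theorem IsProP.exists_openNormal_subset (p : ℕ) [hG : IsProP p G] {U : Set G} (hU : IsOpen U)
    (h1 : (1 : G) ∈ U) : ∃ V : OpenNormalSubgroup G, (V : Set G) ⊆ U :=
  have := hG.compact
  have := hG.totallyDisconnected
  ProfiniteGrp.exist_openNormalSubgroup_sub_open_nhds_of_one hU h1

theorem IsProP.exists_pow_mem [hG : IsProP p G] (V : OpenNormalSubgroup G) (g : G) :
    ∃ m : ℕ, g ^ p ^ m ∈ V.toSubgroup := by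
  obtain ⟨m, hm⟩ := hG.isPGroup_quotient V (g : G ⧸ V.toSubgroup)
  exact ⟨m, (QuotientGroup.eq_one_iff _).1 (by simpa using hm)⟩

theorem IsProP.of_isClosed [hG : IsProP p G] (N : Subgroup G) (hN : IsClosed (N : Set G)) :
    IsProP p N where
  compact := by
    have := hG.compact
    exact isCompact_iff_compactSpace.1 hN.isCompact
  totallyDisconnected := by
    have := hG.totallyDisconnected
    infer_instance
  isPGroup_quotient V := by
    obtain ⟨U, hU, hUV⟩ := isOpen_induced_iff.1 V.isOpen'
    have h1 : (1 : G) ∈ U := by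
      have : (1 : N) ∈ Subtype.val ⁻¹' U := by rw [hUV]; exact V.one_mem'
      exact this
    obtain ⟨W, hW⟩ := IsProP.exists_openNormal_subset p hU h1
    intro q
    induction q using QuotientGroup.induction_on with
    | H g =>
      obtain ⟨m, hm⟩ := IsProP.exists_pow_mem (p := p) W (g : G)
      refine ⟨m, ?_⟩
      rw [← QuotientGroup.mk_pow, QuotientGroup.eq_one_iff]
      have : g ^ p ^ m ∈ Subtype.val ⁻¹' U := hW hm
      rw [hUV] at this
      exact this

theorem IsProP.quotient [hG : IsProP p G] (K : Subgroup G) [K.Normal]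
    (hK : IsClosed (K : Set G)) : IsProP p (G ⧸ K) where
  compact := by
    have := hG.compact
    infer_instance
  totallyDisconnected := by
    have : IsClosed (K : Set G) := hK
    have : T2Space (G ⧸ K) := inferInstance
    suffices TotallySeparatedSpace (G ⧸ K) from inferInstance
    rw [totallySeparatedSpace_iff_exists_isClopen]
    intro x y hxy
    have hU : IsOpen ((QuotientGroup.mk : G → G ⧸ K) ⁻¹' {x⁻¹ * y}ᶜ) :=
      isOpen_compl_singleton.preimage continuous_quotient_mk'
    have h1 : (1 : G) ∈ (QuotientGroup.mk : G → G ⧸ K) ⁻¹' {x⁻¹ * y}ᶜ := by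
      intro h
      apply hxy
      have h' : (1 : G ⧸ K) = x⁻¹ * y := h
      exact (inv_mul_eq_one.1 h'.symm)
    obtain ⟨V, hV⟩ := IsProP.exists_openNormal_subset p hU h1
    let V' : Subgroup (G ⧸ K) := V.toSubgroup.map (QuotientGroup.mk' K)
    have hV' : IsOpen (V' : Set (G ⧸ K)) := QuotientGroup.isOpenMap_coe _ V.isOpen'
    have hc : IsClopen (V' : Set (G ⧸ K)) := ⟨V'.isClosed_of_isOpen hV', hV'⟩
    refine ⟨(fun c => x⁻¹ * c) ⁻¹' V', hc.preimage (continuous_const_mul x⁻¹), ?_, ?_⟩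
    · simp [V'.one_mem]
    · rintro ⟨v, hv, hvy⟩
      exact hV hv hvy
  isPGroup_quotient V := by
    intro q
    induction q using QuotientGroup.induction_on with
    | H g =>
      induction g using QuotientGroup.induction_on with
      | H g =>
        let W : OpenNormalSubgroup G :=
          { toSubgroup := V.toSubgroup.comap (QuotientGroup.mk' K)
            isOpen' := V.isOpen'.preimage continuous_quotient_mk' }
        obtain ⟨m, hm⟩ := IsProP.exists_pow_mem (p := p) W g
        refine ⟨m, ?_⟩
        rw [← QuotientGroup.mk_pow, QuotientGroup.eq_one_iff]
        exact hm

instance IsProP.openNormalSubgroup [hG : IsProP p G] (N : OpenNormalSubgroup G) :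
    IsProP p N.toSubgroup :=
  IsProP.of_isClosed _ N.toOpenSubgroup.isClosed

instance IsProP.topologicalAbelianization [hG : IsProP p G] :
    IsProP p (TopologicalAbelianization G) :=
  IsProP.quotient _ (Subgroup.isClosed_topologicalClosure _)

theorem IsProP.eq_of_forall_mk_eq (p : ℕ) [hG : IsProP p G] {x y : G}
    (h : ∀ V : OpenNormalSubgroup G, (x : G ⧸ V.toSubgroup) = y) : x = y := by
  have := hG.totallyDisconnected
  by_contra hxy
  obtain ⟨V, hV⟩ := IsProP.exists_openNormal_subset p (U := {x⁻¹ * y}ᶜ) isOpen_compl_singleton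
    (fun h' => hxy (inv_mul_eq_one.1 (Eq.symm h')))
  exact hV (QuotientGroup.eq.1 (h V)) rfl

theorem exists_pow_mk_eq_one {p : ℕ} {A : Type*} [CommGroup A] [TopologicalSpace A]
    [IsTopologicalGroup A] [IsProP p A] (V : OpenNormalSubgroup A) (a : A) :
    ∃ m₀ : ℕ, ∀ m, m₀ ≤ m → (a : A ⧸ V.toSubgroup) ^ p ^ m = 1 := by
  obtain ⟨m, hm⟩ := IsProP.exists_pow_mem (p := p) V a
  refine ⟨m, fun n hn => ?_⟩
  obtain ⟨c, hc⟩ := pow_dvd_pow p hn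
  rw [hc, pow_mul, ← QuotientGroup.mk_pow, (QuotientGroup.eq_one_iff _).2 hm, one_pow]

end ProP

/-! ### Powers with p-adic exponents -/

section PadicPow

variable {p : ℕ} [Fact p.Prime] {A : Type*} [CommGroup A] [TopologicalSpace A]
  [IsTopologicalGroup A]

/-- The power `a ^ z` with `z ∈ ℤ_p` in an abelian pro-`p` group, namely the limit of the
`a ^ k` for natural numbers `k` converging `p`-adically to `z`. -/
noncomputable def padicPow (z : ℤ_[p]) (a : A) : A :=
  haveI : Nonempty A := ⟨a⟩
  Filter.limUnder Filter.atTop fun n : ℕ => a ^ z.appr n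

theorem pow_eq_pow_of_padic_sub_mem {B : Type*} [Group B] {b : B} {m : ℕ} (hb : b ^ p ^ m = 1)
    {k l : ℕ} (h : (k : ℤ_[p]) - l ∈ Ideal.span {(p : ℤ_[p]) ^ m}) : b ^ k = b ^ l := by
  have h1 : ((p ^ m : ℕ) : ℤ) ∣ (k : ℤ) - l := by
    rw [← PadicInt.norm_le_pow_iff_mem_span_pow] at h
    have h2 : ‖(((k : ℤ) - l : ℤ) : ℤ_[p])‖ ≤ (p : ℝ) ^ (-(m : ℤ)) := by
      push_cast
      exact h
    rw [PadicInt.norm_int_le_pow_iff_dvd] at h2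
    exact_mod_cast h2
  have h2 : k ≡ l [MOD p ^ m] := ((Nat.modEq_iff_dvd).2 (by simpa using h1)).symm
  exact pow_eq_pow_iff_modEq.2 (h2.of_dvd (orderOf_dvd_of_pow_eq_one hb))

theorem tendsto_padicPow [hA : IsProP p A] (z : ℤ_[p]) (a : A) :
    Filter.Tendsto (fun n : ℕ => a ^ z.appr n) Filter.atTop (nhds (padicPow z a)) := by
  have := hA.compact
  have : Nonempty A := ⟨a⟩
  refine tendsto_nhds_limUnder ?_
  obtain ⟨b, hb⟩ := exists_clusterPt_of_compactSpace
    (Filter.map (fun n : ℕ => a ^ z.appr n) Filter.atTop)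
  refine ⟨b, fun U hU => ?_⟩
  obtain ⟨O, hOU, hO, hbO⟩ := mem_nhds_iff.1 hU
  obtain ⟨V, hV⟩ := IsProP.exists_openNormal_subset p (U := (fun v => b * v) ⁻¹' O)
    (hO.preimage (continuous_const_mul b)) (by simpa using hbO)
  obtain ⟨m, hm⟩ := IsProP.exists_pow_mem (p := p) V a
  have hm' : (a : A ⧸ V.toSubgroup) ^ p ^ m = 1 := by
    rw [← QuotientGroup.mk_pow]; exact (QuotientGroup.eq_one_iff _).2 hm
  have hbV : {c : A | (b : A ⧸ V.toSubgroup) = c} ∈ nhds b := by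
    have : IsOpen ((fun c => b⁻¹ * c) ⁻¹' (V : Set A)) :=
      V.isOpen'.preimage (continuous_const_mul b⁻¹)
    refine Filter.mem_of_superset (this.mem_nhds (by simp)) fun c hc => ?_
    exact QuotientGroup.eq.2 hc
  have hfreq : ∃ᶠ n in Filter.atTop, (b : A ⧸ V.toSubgroup) = ((a ^ z.appr n : A) : A ⧸ V.toSubgroup) :=
    (mapClusterPt_iff_frequently.1 hb) _ hbV
  obtain ⟨n₀, hn₀, h₀⟩ := (Filter.frequently_atTop.1 hfreq) m
  refine Filter.mem_map.2 (Filter.mem_atTop_sets.2 ⟨m, fun n hn => hOU ?_⟩)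
  have key : (b : A ⧸ V.toSubgroup) = ((a ^ z.appr n : A) : A ⧸ V.toSubgroup) := by
    rw [h₀, QuotientGroup.mk_pow, QuotientGroup.mk_pow]
    refine pow_eq_pow_of_padic_sub_mem hm' ?_
    have e : ((z.appr n₀ : ℕ) : ℤ_[p]) - (z.appr n : ℕ)
        = (z - (z.appr n : ℕ)) - (z - (z.appr n₀ : ℕ)) := by ring
    rw [e]
    exact sub_mem
      (Ideal.span_singleton_le_span_singleton.2 (pow_dvd_pow _ hn) (PadicInt.appr_spec n z))
      (Ideal.span_singleton_le_span_singleton.2 (pow_dvd_pow _ hn₀) (PadicInt.appr_spec n₀ z))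
  have := hV (QuotientGroup.eq.1 key)
  simpa using this

theorem mk_padicPow [hA : IsProP p A] (V : OpenNormalSubgroup A) (z : ℤ_[p]) (a : A) {m : ℕ}
    (hm : (a : A ⧸ V.toSubgroup) ^ p ^ m = 1) {k : ℕ}
    (hk : z - k ∈ Ideal.span {(p : ℤ_[p]) ^ m}) :
    ((padicPow z a : A) : A ⧸ V.toSubgroup) = (a : A ⧸ V.toSubgroup) ^ k := by
  have hO : {c : A | ((padicPow z a : A) : A ⧸ V.toSubgroup) = c} ∈ nhds (padicPow z a) := by
    have : IsOpen ((fun c => (padicPow z a)⁻¹ * c) ⁻¹' (V : Set A)) :=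
      V.isOpen'.preimage (continuous_const_mul (padicPow z a)⁻¹)
    refine Filter.mem_of_superset (this.mem_nhds (by simp)) fun c hc => ?_
    exact QuotientGroup.eq.2 hc
  obtain ⟨n, hn, hmn⟩ :=
    (((tendsto_padicPow z a).eventually hO).and (Filter.eventually_ge_atTop m)).exists
  have hn' : ((padicPow z a : A) : A ⧸ V.toSubgroup) = ((a ^ z.appr n : A) : A ⧸ V.toSubgroup) := hn
  rw [hn', QuotientGroup.mk_pow]
  refine pow_eq_pow_of_padic_sub_mem hm ?_
  have e : ((z.appr n : ℕ) : ℤ_[p]) - k = (z - k) - (z - (z.appr n : ℕ)) := by ring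
  rw [e]
  exact sub_mem hk
    (Ideal.span_singleton_le_span_singleton.2 (pow_dvd_pow _ hmn) (PadicInt.appr_spec n z))

end PadicPow

/-! ### The abelianization of a pro-p group as a module over the p-adic integers -/

/-- The abelianization `G_ab`, the quotient of `G` by the closure of its commutator subgroup,
written additively. -/
def AbMod (G : Type*) [Group G] [TopologicalSpace G] [IsTopologicalGroup G] : Type _ :=
  Additive (TopologicalAbelianization G)

namespace AbMod

variable {G : Type*} [Group G] [TopologicalSpace G] [IsTopologicalGroup G]

noncomputable instance : AddCommGroup (AbMod G) :=
  inferInstanceAs (AddCommGroup (Additive (TopologicalAbelianization G)))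

/-- The class of an element of `G` in `G_ab`. -/
def of (g : G) : AbMod G := Additive.ofMul (g : TopologicalAbelianization G)

variable {p : ℕ} [Fact p.Prime]

/-- The `ℤ_p`-module structure on `G_ab` for a pro-`p` group `G`. -/
noncomputable instance [IsProP p G] : Module ℤ_[p] (AbMod G) where
  smul z a := Additive.ofMul (padicPow z (Additive.toMul a))
  one_smul a := by
    refine IsProP.eq_of_forall_mk_eq (G := TopologicalAbelianization G) p fun V => ?_
    obtain ⟨m, hm⟩ := exists_pow_mk_eq_one (p := p) V (Additive.toMul a)
    exact (mk_padicPow V 1 _ (hm m le_rfl) (k := 1) (by simp)).trans (pow_one _)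
  mul_smul z w a := by
    refine IsProP.eq_of_forall_mk_eq (G := TopologicalAbelianization G) p fun V => ?_
    obtain ⟨m₁, hm₁⟩ := exists_pow_mk_eq_one (p := p) V (Additive.toMul a)
    obtain ⟨m₂, hm₂⟩ := exists_pow_mk_eq_one (p := p) V (padicPow w (Additive.toMul a))
    set m := max m₁ m₂
    have h1 := hm₁ m (le_max_left _ _)
    have h2 := hm₂ m (le_max_right _ _)
    have e1 := mk_padicPow V w _ h1 (PadicInt.appr_spec m w)
    have e2 := mk_padicPow V z _ h2 (PadicInt.appr_spec m z)
    have e3 := mk_padicPow V (z * w) _ h1 (k := w.appr m * z.appr m) (by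
      have e : z * w - ((w.appr m * z.appr m : ℕ) : ℤ_[p])
          = w * (z - (z.appr m : ℕ)) + (z.appr m : ℕ) * (w - (w.appr m : ℕ)) := by
        push_cast; ring
      rw [e]
      exact add_mem (Ideal.mul_mem_left _ _ (PadicInt.appr_spec m z))
        (Ideal.mul_mem_left _ _ (PadicInt.appr_spec m w)))
    exact e3.trans (by rw [pow_mul, ← e1]; exact e2.symm)
  smul_zero z := by
    refine IsProP.eq_of_forall_mk_eq (G := TopologicalAbelianization G) p fun V => ?_
    exact (mk_padicPow V z (1 : TopologicalAbelianization G) (m := 0) (k := 0)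
      (by simp) (by simp)).trans (pow_zero _)
  smul_add z a b := by
    refine IsProP.eq_of_forall_mk_eq (G := TopologicalAbelianization G) p fun V => ?_
    obtain ⟨m₁, hm₁⟩ := exists_pow_mk_eq_one (p := p) V (Additive.toMul a)
    obtain ⟨m₂, hm₂⟩ := exists_pow_mk_eq_one (p := p) V (Additive.toMul b)
    set m := max m₁ m₂
    have h1 := hm₁ m (le_max_left _ _)
    have h2 := hm₂ m (le_max_right _ _)
    have e1 := mk_padicPow V z _ h1 (PadicInt.appr_spec m z)
    have e2 := mk_padicPow V z _ h2 (PadicInt.appr_spec m z)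
    have e3 := mk_padicPow V z (Additive.toMul a * Additive.toMul b) (m := m)
      (by rw [QuotientGroup.mk_mul, mul_pow, h1, h2, one_mul]) (PadicInt.appr_spec m z)
    exact e3.trans (by
      rw [QuotientGroup.mk_mul, mul_pow, ← e1, ← e2]; exact (QuotientGroup.mk_mul _ _ _).symm)
  add_smul z w a := by
    refine IsProP.eq_of_forall_mk_eq (G := TopologicalAbelianization G) p fun V => ?_
    obtain ⟨m, hm⟩ := exists_pow_mk_eq_one (p := p) V (Additive.toMul a)
    have h := hm m le_rfl
    have e1 := mk_padicPow V z _ h (PadicInt.appr_spec m z)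
    have e2 := mk_padicPow V w _ h (PadicInt.appr_spec m w)
    have e3 := mk_padicPow V (z + w) _ h (k := z.appr m + w.appr m) (by
      have e : z + w - ((z.appr m + w.appr m : ℕ) : ℤ_[p])
          = (z - (z.appr m : ℕ)) + (w - (w.appr m : ℕ)) := by push_cast; ring
      rw [e]
      exact add_mem (PadicInt.appr_spec m z) (PadicInt.appr_spec m w))
    exact e3.trans (by rw [pow_add, ← e1, ← e2]; exact (QuotientGroup.mk_mul _ _ _).symm)
  zero_smul a := by
    refine IsProP.eq_of_forall_mk_eq (G := TopologicalAbelianization G) p fun V => ?_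
    obtain ⟨m, hm⟩ := exists_pow_mk_eq_one (p := p) V (Additive.toMul a)
    exact (mk_padicPow V 0 _ (hm m le_rfl) (k := 0) (by simp)).trans (pow_zero _)

theorem smul_def [IsProP p G] (z : ℤ_[p]) (a : AbMod G) :
    z • a = Additive.ofMul (padicPow z (Additive.toMul a)) := rfl

/-- The `ℤ_p`-linear map `G_ab → H_ab` induced by a continuous homomorphism `G → H`. -/
noncomputable def map {H : Type*} [Group H] [TopologicalSpace H] [IsTopologicalGroup H]
    [IsProP p G] [IsProP p H] (f : G →ₜ* H) : AbMod G →ₗ[ℤ_[p]] AbMod H :=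
  have hle : (commutator G).topologicalClosure ≤
      ((commutator H).topologicalClosure).comap f.toMonoidHom := by
    refine Subgroup.topologicalClosure_minimal _ ?_
      ((Subgroup.isClosed_topologicalClosure _).preimage f.continuous_toFun)
    rw [← Subgroup.map_le_iff_le_comap]
    refine le_trans ?_ (Subgroup.le_topologicalClosure _)
    rw [commutator_def, Subgroup.map_commutator]
    exact Subgroup.commutator_mono le_top le_top
  let φ : TopologicalAbelianization G →* TopologicalAbelianization H :=
    QuotientGroup.map _ _ f.toMonoidHom hle
  { toFun := fun a => Additive.ofMul (φ (Additive.toMul a))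
    map_add' := fun a b => map_mul φ (Additive.toMul a) (Additive.toMul b)
    map_smul' := fun z a => by
      have hφ : Continuous φ :=
        continuous_quot_lift _ (continuous_quotient_mk'.comp f.continuous_toFun)
      have : T2Space (TopologicalAbelianization H) := by
        have : IsClosed ((commutator H).topologicalClosure : Set H) :=
          Subgroup.isClosed_topologicalClosure _
        infer_instance
      have h1 := (hφ.tendsto _).comp (tendsto_padicPow z (Additive.toMul a))
      have h2 := tendsto_padicPow z (φ (Additive.toMul a))
      refine tendsto_nhds_unique (X := TopologicalAbelianization H) h1 (h2.congr fun n => ?_)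
      exact (map_pow φ _ _).symm }

theorem map_of {H : Type*} [Group H] [TopologicalSpace H] [IsTopologicalGroup H]
    [IsProP p G] [IsProP p H] (f : G →ₜ* H) (g : G) :
    map (p := p) f (of g) = of (f g) := rfl

theorem of_surjective : Function.Surjective (of : G → AbMod G) :=
  QuotientGroup.mk_surjective

end AbMod

/-! ### The conjugation action of `G/N` on the abelianization of `N` -/

section Conj

variable {p : ℕ} [Fact p.Prime] {G : Type*} [Group G] [TopologicalSpace G] [IsTopologicalGroup G]
  (N : Subgroup G) [N.Normal]

/-- Conjugation `n ↦ g n g⁻¹` as a continuous endomorphism of the normal subgroup `N`. -/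
def conjHom (g : G) : N →ₜ* N where
  toMonoidHom := (MulAut.conjNormal g : MulAut N).toMonoidHom
  continuous_toFun :=
    ((continuous_mul_const g⁻¹).comp ((continuous_const_mul g).comp
      continuous_subtype_val)).subtype_mk _

theorem coe_conjHom (g : G) (n : N) : (conjHom N g n : G) = g * n * g⁻¹ := rfl

variable (p) in
/-- The action of `G` on `N_ab` induced by conjugation. -/
noncomputable def conjRepAux [IsProP p N] : Representation ℤ_[p] G (AbMod N) where
  toFun g := AbMod.map (conjHom N g)
  map_one' := by
    refine LinearMap.ext fun a => ?_
    obtain ⟨n, rfl⟩ := AbMod.of_surjective a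
    rw [AbMod.map_of]
    exact congrArg AbMod.of (Subtype.ext (by simp [coe_conjHom]))
  map_mul' g h := by
    refine LinearMap.ext fun a => ?_
    obtain ⟨n, rfl⟩ := AbMod.of_surjective a
    rw [Module.End.mul_apply, AbMod.map_of, AbMod.map_of, AbMod.map_of]
    exact congrArg AbMod.of (Subtype.ext (by simp [coe_conjHom, mul_assoc]))

variable (p) in
/-- The action of `G/N` on `N_ab` induced by conjugation of `G` on `N`. -/
noncomputable def conjRep [IsProP p N] : Representation ℤ_[p] (G ⧸ N) (AbMod N) :=
  QuotientGroup.lift N (conjRepAux p N) fun g hg => by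
    refine LinearMap.ext fun a => ?_
    obtain ⟨n, rfl⟩ := AbMod.of_surjective a
    refine (AbMod.map_of _ _).trans (QuotientGroup.eq.2 (Subgroup.le_topologicalClosure _ ?_))
    have e : (conjHom N g n)⁻¹ * n = ⁅(⟨g, hg⟩ : N), n⁻¹⁆ :=
      Subtype.ext (by simp [coe_conjHom, commutatorElement_def, mul_assoc])
    rw [e]
    exact Subgroup.commutator_mem_commutator (Subgroup.mem_top _) (Subgroup.mem_top _)

/-- The class of `g ∈ G` acts on the class of `n ∈ N` by `n ↦ g n g⁻¹`. -/
theorem conjRep_apply [IsProP p N] (g : G) (n : N) :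
    conjRep p N (g : G ⧸ N) (AbMod.of n) = AbMod.of (MulAut.conjNormal g n) := rfl

variable (p) in
/-- The representation of `G/N` on `N_ab ⊗ ℚ_p` over `ℚ_p` induced by conjugation. -/
noncomputable def rationalConjRep [IsProP p N] :
    Representation ℚ_[p] (G ⧸ N) (ℚ_[p] ⊗[ℤ_[p]] AbMod N) :=
  ((Module.End.baseChangeHom ℤ_[p] ℚ_[p] (AbMod N)).toRingHom : _ →* _).comp (conjRep p N)

theorem rationalConjRep_tmul [IsProP p N] (q : G ⧸ N) (c : ℚ_[p]) (a : AbMod N) :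
    rationalConjRep p N q (c ⊗ₜ[ℤ_[p]] a) = c ⊗ₜ[ℤ_[p]] conjRep p N q a := rfl

end Conj

/-!
Let `Γ = G/N`, let `c = |Γ|`, and let `G` be free on `x₁, …, xₙ`. Evaluation at the `xᵢ` identifies
`H¹(G, 𝔽_p)` with `𝔽_p^n`, so that `d_G = n` (`IsFreeProPOn.genRank_eq`).

The isomorphism comes from the relation sequence
`0 → N_ab → ℤ_p[Γ]^n → ℤ_p[Γ] → ℤ_p → 0`, with boundary map `∂ eᵢ = x̄ᵢ - 1`. The sequence is split
explicitly after inverting `c`, without appeal to semisimplicity or to a rank count.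

Continuous crossed homomorphisms from `G` to a pro-`p` `Γ`-module `A` are the lifts of `G → Γ` to
`A ⋊ Γ`. As this group is pro-`p`, freeness gives a unique crossed homomorphism with prescribed
values at the `xᵢ` (`IsFreeProPOn.exists_crossedHom`, `IsFreeProPOn.crossedHom_ext`). Hence there is
a Fox derivative `D : G → ℤ_p[Γ]^n` with `D xᵢ = eᵢ`, through which every other crossed homomorphism
factors (`IsFreeProPOn.extendBasis_foxDerivative`). Its restriction to `N` is the map
`N_ab → ℤ_p[Γ]^n`, and applying the factorization to `g ↦ ḡ - 1` gives `∂ (D g) = ḡ - 1`.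

The splitting is the transfer `t : G → N_ab`, `t g = ∑ δ, g s(δ) s(ḡδ)⁻¹` for a set-theoretic
section `s`. It is a crossed homomorphism with `t = c` on `N`, so it factors as `t = φ ∘ D` for an
equivariant `φ : ℤ_p[Γ]^n → N_ab` with `φ ∘ D = c` on `N_ab`. With `S = ∑ δ, D (s δ)`, the
definition of `t` gives `D (t g) = c D g + (ḡ - 1) S` (`IsContCrossedHom.map_transferAb`), that is,
`D (φ m) = c m + ∂(m) S` for all `m`, and `∂ S = ∑ γ - c`. Over `ℚ_p` these identities make
`(b, m) ↦ (φ m, ∂ m + b ∑ γ)` an isomorphism from `ℚ_p ⊕ ℚ_p[Γ]^n` onto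
`(N_ab ⊗ ℚ_p) ⊕ ℚ_p[Γ]` (`nonempty_equiv_of_splitting`).
-/

/-! ### Semidirect products of topological groups -/

namespace SemidirectProduct

variable {K Γ : Type*} [Group K] [TopologicalSpace K] [Group Γ] [TopologicalSpace Γ]
  {φ : Γ →* MulAut K}

/-- A semidirect product carries the topology of the product of its two factors. -/
instance : TopologicalSpace (K ⋊[φ] Γ) :=
  .induced SemidirectProduct.equivProd inferInstance

variable (φ) in
/-- The homeomorphism between a semidirect product and the product of its factors. -/
def homeomorphProd : K ⋊[φ] Γ ≃ₜ K × Γ :=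
  SemidirectProduct.equivProd.toHomeomorphOfIsInducing ⟨rfl⟩

theorem continuous_left : Continuous (left : K ⋊[φ] Γ → K) :=
  continuous_fst.comp (homeomorphProd φ).continuous

theorem continuous_right : Continuous (right : K ⋊[φ] Γ → Γ) :=
  continuous_snd.comp (homeomorphProd φ).continuous

theorem continuous_mk {X : Type*} [TopologicalSpace X] {f : X → K} {g : X → Γ}
    (hf : Continuous f) (hg : Continuous g) :
    Continuous fun x => (⟨f x, g x⟩ : K ⋊[φ] Γ) :=
  (homeomorphProd φ).symm.continuous.comp (hf.prodMk hg)

theorem isTopologicalGroup [IsTopologicalGroup K] [DiscreteTopology Γ]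
    (hφ : ∀ γ, Continuous (φ γ)) : IsTopologicalGroup (K ⋊[φ] Γ) := by
  have hact : Continuous fun q : Γ × K => φ q.1 q.2 :=
    continuous_prod_of_discrete_left.2 hφ
  refine { continuous_mul := ?_, continuous_inv := ?_ }
  · exact continuous_mk
      ((continuous_left.comp continuous_fst).mul (hact.comp
        ((continuous_right.comp continuous_fst).prodMk (continuous_left.comp continuous_snd))))
      ((continuous_right.comp continuous_fst).mul (continuous_right.comp continuous_snd))
  · exact continuous_mk
      (hact.comp (continuous_right.inv.prodMk continuous_left.inv)) continuous_right.inv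

/-- A semidirect product of a pro-`p` group with a finite `p`-group is a pro-`p` group. -/
theorem isProP {p : ℕ} [IsTopologicalGroup K] [hK : IsProP p K] [DiscreteTopology Γ] [Finite Γ]
    (hΓ : IsPGroup p Γ) [IsTopologicalGroup (K ⋊[φ] Γ)] : IsProP p (K ⋊[φ] Γ) where
  compact := by
    have := hK.compact
    exact (homeomorphProd φ).symm.compactSpace
  totallyDisconnected := by
    have := hK.totallyDisconnected
    exact (homeomorphProd φ).isEmbedding.isTotallyDisconnected
      (isTotallyDisconnected_of_totallyDisconnectedSpace _) |> fun h => ⟨by simpa using h⟩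
  isPGroup_quotient V := by
    intro q
    induction q using QuotientGroup.induction_on with
    | H g =>
      obtain ⟨a, ha⟩ := hΓ g.right
      have hr : (g ^ p ^ a).right = 1 := by
        rw [← ha]; exact map_pow (rightHom (φ := φ)) g _
      have hl : g ^ p ^ a = inl (g ^ p ^ a).left := by
        ext <;> simp [hr]
      let W : OpenNormalSubgroup K :=
        { toSubgroup := V.toSubgroup.comap inl
          isOpen' := V.isOpen'.preimage (continuous_mk continuous_id continuous_const) }
      obtain ⟨b, hb⟩ := IsProP.exists_pow_mem (p := p) W (g ^ p ^ a).left
      refine ⟨a + b, ?_⟩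
      rw [← QuotientGroup.mk_pow, QuotientGroup.eq_one_iff, pow_add, pow_mul, hl, ← map_pow]
      exact hb

end SemidirectProduct

/-! ### Free generators and `H¹` -/

section Generation

theorem contCoboundaries₁_eq_bot (p : ℕ) (G : Type*) : contCoboundaries₁ p G = ⊥ := by
  rw [contCoboundaries₁, Submodule.span_eq_bot]
  rintro _ ⟨a, rfl⟩
  funext g
  simp

variable {p : ℕ} {G : Type u} [Group G] [TopologicalSpace G] [IsTopologicalGroup G]
  [hG : IsProP p G] {n : ℕ} {x : Fin n → G}

/-- The free generators of a free pro-`p` group generate it topologically: the inclusion of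
the closed subgroup `K` they generate has a retraction, by the universal property applied to `K`,
and by uniqueness the resulting endomorphism of `G` is the identity. -/
theorem IsFreeProPOn.topologicalClosure_closure (hx : IsFreeProPOn p x) :
    (Subgroup.closure (Set.range x)).topologicalClosure = ⊤ := by
  set K := (Subgroup.closure (Set.range x)).topologicalClosure with hKdef
  have hK : IsClosed (K : Set G) := Subgroup.isClosed_topologicalClosure _
  have := IsProP.of_isClosed (p := p) K hK
  have hxK : ∀ i, x i ∈ K := fun i =>
    Subgroup.le_topologicalClosure _ (Subgroup.subset_closure ⟨i, rfl⟩)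
  obtain ⟨ψ, hψ, -⟩ := hx K fun i => ⟨x i, hxK i⟩
  let ι : K →ₜ* G := ⟨K.subtype, continuous_subtype_val⟩
  have h : ι.comp ψ = ContinuousMonoidHom.id G :=
    (hx G x).unique (fun i => congrArg Subtype.val (hψ i)) fun i => rfl
  refine top_unique fun g _ => ?_
  have : ((ψ g : K) : G) = g := DFunLike.congr_fun h g
  rw [← this]
  exact (ψ g).2

/-- A closed subgroup containing the free generators is everything. -/
theorem IsFreeProPOn.mem_of_isClosed (hx : IsFreeProPOn p x) (L : Subgroup G)
    (hL : IsClosed (L : Set G)) (h : ∀ i, x i ∈ L) (g : G) : g ∈ L := by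
  have : (Subgroup.closure (Set.range x)).topologicalClosure ≤ L :=
    Subgroup.topologicalClosure_minimal _
      ((Subgroup.closure_le _).2 (Set.range_subset_iff.2 h)) hL
  exact this (hx.topologicalClosure_closure ▸ Subgroup.mem_top g)

/-- A finite discrete `p`-group is pro-`p`. -/
theorem IsPGroup.isProP {P : Type*} [Group P] [TopologicalSpace P] [IsTopologicalGroup P]
    [Finite P] [DiscreteTopology P] (h : IsPGroup p P) : IsProP p P where
  compact := inferInstance
  totallyDisconnected := inferInstance
  isPGroup_quotient V := h.to_quotient V.toSubgroup

/-- A continuous homomorphism from a free pro-`p` group to `𝔽_p` is given by arbitrary values on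
the free generators. -/
theorem IsFreeProPOn.bijective_eval [Fact p.Prime] (hx : IsFreeProPOn p x) :
    Function.Bijective fun (f : contCocycles₁ p G) (i : Fin n) => (f : G → ZMod p) (x i) := by
  have h1 : ∀ f : contCocycles₁ p G, (f : G → ZMod p) 1 = 0 := fun f => by
    simpa using f.2.2 1 1
  constructor
  · intro f f' hff'
    have key : ∀ g, g ∈ ({
        carrier := {g | (f : G → ZMod p) g = (f' : G → ZMod p) g}
        mul_mem' := fun {a b} ha hb => by
          have ha' : (f : G → ZMod p) a = (f' : G → ZMod p) a := ha
          have hb' : (f : G → ZMod p) b = (f' : G → ZMod p) b := hb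
          change (f : G → ZMod p) (a * b) = (f' : G → ZMod p) (a * b)
          rw [f.2.2, f'.2.2, ha', hb']
        one_mem' := (h1 f).trans (h1 f').symm
        inv_mem' := fun {a} ha => by
          have ha' : (f : G → ZMod p) a = (f' : G → ZMod p) a := ha
          have e := f.2.2 a a⁻¹
          have e' := f'.2.2 a a⁻¹
          rw [mul_inv_cancel, h1] at e e'
          rw [ha'] at e
          exact add_left_cancel (e.symm.trans e') } : Subgroup G) :=
      hx.mem_of_isClosed _ (isClosed_eq f.2.1 f'.2.1) fun i => congrFun hff' i
    exact Subtype.ext (funext key)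
  · intro a
    -- `PUnit → Multiplicative 𝔽_p` is a copy of `𝔽_p` in the universe of `G`
    let H := PUnit.{u + 1} → Multiplicative (ZMod p)
    have hp : IsPGroup p H := IsPGroup.of_card (n := 1) (by simp [H, Nat.card_eq_fintype_card])
    have : IsProP p H := hp.isProP
    obtain ⟨ψ, hψ, -⟩ := hx H fun i _ => Multiplicative.ofAdd (a i)
    refine ⟨⟨fun g => (ψ g PUnit.unit).toAdd, ?_, fun g h => ?_⟩, funext fun i => ?_⟩
    · exact continuous_toAdd.comp ((continuous_apply _).comp ψ.continuous_toFun)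
    · exact congrArg (fun q : H => (q PUnit.unit).toAdd) (map_mul ψ g h)
    · simp [hψ]

/-- The number of free generators of a free pro-`p` group is `dim H¹(G, 𝔽_p)`. -/
theorem IsFreeProPOn.genRank_eq [Fact p.Prime] (hx : IsFreeProPOn p x) : genRank p G = n := by
  let e : contCocycles₁ p G ≃ₗ[ZMod p] (Fin n → ZMod p) :=
    LinearEquiv.ofBijective
      { toFun := fun (f : contCocycles₁ p G) i => (f : G → ZMod p) (x i)
        map_add' := fun _ _ => rfl
        map_smul' := fun _ _ => rfl } hx.bijective_eval
  have hbot : (contCoboundaries₁ p G).comap (contCocycles₁ p G).subtype = ⊥ := by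
    rw [contCoboundaries₁_eq_bot]
    exact (Submodule.ker_subtype _)
  rw [genRank, ((Submodule.quotEquivOfEqBot _ hbot).trans e).finrank_eq, Module.finrank_fin_fun]

end Generation

/-! ### Continuous crossed homomorphisms -/

section CrossedHom

variable {p : ℕ} {G : Type u} [Group G] [TopologicalSpace G] {N : Subgroup G} [N.Normal]
  {k : Type*} [CommSemiring k]
  {A : Type u} [AddCommGroup A] [Module k A] [TopologicalSpace A]
  {ρ : Representation k (G ⧸ N) A}

/-- A continuous crossed homomorphism (inhomogeneous `1`-cocycle) from `G` to a topological abelian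
group `A` on which `G` acts through `G/N`. -/
structure IsContCrossedHom (ρ : Representation k (G ⧸ N) A) (d : G → A) : Prop where
  continuous : Continuous d
  map_mul : ∀ g h, d (g * h) = d g + ρ g (d h)

theorem IsContCrossedHom.map_one {d : G → A} (hd : IsContCrossedHom ρ d) : d 1 = 0 := by
  simpa using hd.map_mul 1 1

theorem IsContCrossedHom.map_inv {d : G → A} (hd : IsContCrossedHom ρ d) (g : G) :
    d g⁻¹ = - ρ (g⁻¹ : G) (d g) := by
  have := hd.map_mul g⁻¹ g
  rw [inv_mul_cancel, hd.map_one] at this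
  exact eq_neg_of_add_eq_zero_left this.symm

/-- On `N`, which acts trivially, a crossed homomorphism is a homomorphism. -/
theorem IsContCrossedHom.map_mul_of_mem {d : G → A} (hd : IsContCrossedHom ρ d) {n : G}
    (hn : n ∈ N) (g : G) : d (n * g) = d n + d g := by
  rw [hd.map_mul, (QuotientGroup.eq_one_iff n).2 hn, _root_.map_one ρ, Module.End.one_apply]

/-- The value at a conjugate `g n g⁻¹` with `n ∈ N` is the image of the value at `n`. -/
theorem IsContCrossedHom.map_conj {d : G → A} (hd : IsContCrossedHom ρ d) {n : G}
    (hn : n ∈ N) (g : G) : d (g * n * g⁻¹) = ρ g (d n) := by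
  have h1 := hd.map_mul_of_mem (‹N.Normal›.conj_mem n hn g) g
  rw [inv_mul_cancel_right, hd.map_mul, add_comm] at h1
  exact (add_right_cancel h1).symm

variable [IsTopologicalGroup G] [hG : IsProP p G] {n : ℕ} {x : Fin n → G}

/-- Continuous crossed homomorphisms on a free pro-`p` group are determined by their values on the
free generators. -/
theorem IsFreeProPOn.crossedHom_ext (hx : IsFreeProPOn p x) [T2Space A] {d d' : G → A}
    (hd : IsContCrossedHom ρ d) (hd' : IsContCrossedHom ρ d') (h : ∀ i, d (x i) = d' (x i)) :
    d = d' := by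
  let L : Subgroup G :=
    { carrier := {g | d g = d' g}
      mul_mem' := fun {a b} (ha : d a = d' a) (hb : d b = d' b) => by
        change d (a * b) = d' (a * b)
        rw [hd.map_mul, hd'.map_mul, ha, hb]
      one_mem' := hd.map_one.trans hd'.map_one.symm
      inv_mem' := fun {a} (ha : d a = d' a) => by
        change d a⁻¹ = d' a⁻¹
        rw [hd.map_inv, hd'.map_inv, ha] }
  exact funext fun g => hx.mem_of_isClosed L (isClosed_eq hd.continuous hd'.continuous) h g

/-- A representation, as an action by automorphisms of the underlying group written
multiplicatively. -/
def Representation.toMulAut {Γ : Type*} [Group Γ] (ρ : Representation k Γ A) :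
    Γ →* MulAut (Multiplicative A) where
  toFun γ :=
    { toFun := fun a => .ofAdd (ρ γ a.toAdd)
      invFun := fun a => .ofAdd (ρ γ⁻¹ a.toAdd)
      left_inv := fun a => by
        change Multiplicative.ofAdd ((ρ γ⁻¹ * ρ γ) a.toAdd) = a
        rw [← _root_.map_mul, inv_mul_cancel, _root_.map_one]; rfl
      right_inv := fun a => by
        change Multiplicative.ofAdd ((ρ γ * ρ γ⁻¹) a.toAdd) = a
        rw [← _root_.map_mul, mul_inv_cancel, _root_.map_one]; rfl
      map_mul' := fun a b => congrArg Multiplicative.ofAdd (_root_.map_add (ρ γ) a.toAdd b.toAdd) }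
  map_one' := by ext a; simp
  map_mul' γ δ := by ext a; simp

/-- On a free pro-`p` group, continuous crossed homomorphisms to a pro-`p` module take arbitrary
values on the free generators: crossed homomorphisms to `A` are homomorphisms to `A ⋊ G/N` lifting
the projection `G → G/N`. -/
theorem IsFreeProPOn.exists_crossedHom (hx : IsFreeProPOn p x) (hN : IsOpen (N : Set G))
    [IsTopologicalAddGroup A] [IsProP p (Multiplicative A)] (hρ : ∀ γ, Continuous (ρ γ))
    (a : Fin n → A) : ∃ d : G → A, IsContCrossedHom ρ d ∧ ∀ i, d (x i) = a i := by
  have := hG.compact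
  have : Finite (G ⧸ N) := Subgroup.quotient_finite_of_isOpen N hN
  have : DiscreteTopology (G ⧸ N) := QuotientGroup.discreteTopology hN
  let V : OpenNormalSubgroup G := { toSubgroup := N, isOpen' := hN }
  have hp : IsPGroup p (G ⧸ N) := hG.isPGroup_quotient V
  let φ := ρ.toMulAut
  have : IsTopologicalGroup (Multiplicative A ⋊[φ] (G ⧸ N)) :=
    SemidirectProduct.isTopologicalGroup fun γ =>
      continuous_ofAdd.comp ((hρ γ).comp continuous_toAdd)
  have : IsProP p (Multiplicative A ⋊[φ] (G ⧸ N)) := SemidirectProduct.isProP hp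
  obtain ⟨ψ, hψ, -⟩ := hx (Multiplicative A ⋊[φ] (G ⧸ N)) fun i => ⟨.ofAdd (a i), x i⟩
  have hc : Continuous ψ := ψ.continuous_toFun
  let L : Subgroup G :=
    (SemidirectProduct.rightHom.comp ψ.toMonoidHom).eqLocus (QuotientGroup.mk' N)
  have hr (g : G) : (ψ g).right = g :=
    hx.mem_of_isClosed L
      (isClosed_eq (SemidirectProduct.continuous_right.comp hc) continuous_quotient_mk')
      (fun i => congrArg SemidirectProduct.right (hψ i)) g
  refine ⟨fun g => (ψ g).left.toAdd, ⟨?_, fun g h => ?_⟩, fun i => ?_⟩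
  · exact continuous_toAdd.comp (SemidirectProduct.continuous_left.comp hc)
  · rw [map_mul, SemidirectProduct.mul_left, hr]
    rfl
  · exact congrArg (fun q => q.left.toAdd) (hψ i)

end CrossedHom

/-! ### The topology of the abelianization -/

namespace AbMod

variable {G : Type*} [Group G] [TopologicalSpace G] [IsTopologicalGroup G]

instance : TopologicalSpace (AbMod G) :=
  inferInstanceAs (TopologicalSpace (Additive (TopologicalAbelianization G)))

instance : IsTopologicalAddGroup (AbMod G) :=
  inferInstanceAs (IsTopologicalAddGroup (Additive (TopologicalAbelianization G)))

instance : T2Space (AbMod G) := by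
  have : IsClosed ((commutator G).topologicalClosure : Set G) :=
    Subgroup.isClosed_topologicalClosure _
  exact inferInstanceAs (T2Space (TopologicalAbelianization G))

theorem continuous_of : Continuous (of : G → AbMod G) := continuous_quotient_mk'

theorem of_mul (g h : G) : of (g * h) = of g + of h := rfl

variable {p : ℕ} [Fact p.Prime]

theorem continuous_smul_const [IsProP p G] (a : AbMod G) :
    Continuous fun z : ℤ_[p] => z • a := by
  let f : ℤ_[p] →+ AbMod G := (LinearMap.toSpanSingleton ℤ_[p] (AbMod G) a).toAddMonoidHom
  refine continuous_of_continuousAt_zero f fun U hU => ?_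
  rw [map_zero] at hU
  obtain ⟨O, hOU, hO, h0⟩ := mem_nhds_iff.1 hU
  have hO' : IsOpen (X := TopologicalAbelianization G) O := hO
  obtain ⟨V, hV⟩ := IsProP.exists_openNormal_subset p hO' h0
  obtain ⟨m, hm⟩ := exists_pow_mk_eq_one (p := p) V (Additive.toMul a)
  have hopen : IsOpen (Ideal.span {(p : ℤ_[p]) ^ m} : Set ℤ_[p]) := by
    have : (Ideal.span {(p : ℤ_[p]) ^ m} : Set ℤ_[p]) =
        Metric.closedBall 0 ((p : ℝ) ^ (-(m : ℤ))) := by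
      ext z
      rw [Metric.mem_closedBall, dist_zero_right, PadicInt.norm_le_pow_iff_mem_span_pow]
      rfl
    rw [this]
    exact IsUltrametricDist.isOpen_closedBall _ (by
      have := (Fact.out : p.Prime).pos
      positivity)
  refine Filter.mem_map.2 (Filter.mem_of_superset (hopen.mem_nhds (zero_mem _)) fun z hz => ?_)
  refine hOU (hV ((QuotientGroup.eq_one_iff _).1 ?_))
  exact (mk_padicPow V z _ (hm m le_rfl) (k := 0) (by simpa using hz)).trans (pow_zero _)

/-- A continuous homomorphism from a pro-`p` group `G` to a Hausdorff topological `ℤ_p`-module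
factors through a `ℤ_p`-linear map on `G_ab`; linearity is automatic because `ℕ` is dense
in `ℤ_p`. -/
theorem exists_lift [IsProP p G] {A : Type*} [AddCommGroup A] [TopologicalSpace A]
    [T2Space A] [Module ℤ_[p] A] [ContinuousSMul ℤ_[p] A] (f : G → A) (hf : Continuous f)
    (hmul : ∀ g h, f (g * h) = f g + f h) :
    ∃ l : AbMod G →ₗ[ℤ_[p]] A, ∀ g, l (of g) = f g := by
  let f' : G →* Multiplicative A := MonoidHom.mk' (fun g => .ofAdd (f g)) hmul
  have hle : (commutator G).topologicalClosure ≤ f'.ker := by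
    refine Subgroup.topologicalClosure_minimal _ (Abelianization.commutator_subset_ker f') ?_
    exact isClosed_singleton.preimage (t := {(0 : A)}) hf
  let F : TopologicalAbelianization G →* Multiplicative A := QuotientGroup.lift _ f' hle
  let F' : AbMod G →+ A := F.toAdditiveLeft
  have hF : Continuous F' := continuous_quot_lift _ hf
  refine ⟨{ F' with map_smul' := fun z a => ?_ }, fun g => rfl⟩
  have h : (fun z : ℤ_[p] => F' (z • a)) = fun z => z • F' a := by
    refine PadicInt.denseRange_natCast.equalizer (hF.comp (continuous_smul_const a))
      (continuous_id.smul continuous_const) (funext fun k => ?_)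
    simp only [Function.comp, Nat.cast_smul_eq_nsmul, map_nsmul]
  exact congrFun h z

end AbMod

/-! ### Coefficient modules -/

/-- The representation of `Γ` by left translation on the functions `Γ → B`; for `B = R^n` this is
the free module `R[Γ]^n` when `Γ` is finite. -/
def translationRep (R Γ B : Type*) [CommSemiring R] [Group Γ] [AddCommMonoid B] [Module R B] :
    Representation R Γ (Γ → B) where
  toFun γ := LinearMap.funLeft R B fun δ => γ⁻¹ * δ
  map_one' := by ext f δ; simp [LinearMap.funLeft_apply]
  map_mul' γ δ := by ext f ε; simp [LinearMap.funLeft_apply, mul_assoc]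

theorem translationRep_apply {R Γ B : Type*} [CommSemiring R] [Group Γ] [AddCommMonoid B]
    [Module R B] (γ : Γ) (f : Γ → B) (δ : Γ) : translationRep R Γ B γ f δ = f (γ⁻¹ * δ) := rfl

theorem continuous_translationRep {R Γ B : Type*} [CommSemiring R] [Group Γ] [AddCommMonoid B]
    [Module R B] [TopologicalSpace B] (γ : Γ) : Continuous (translationRep R Γ B γ) :=
  continuous_pi fun δ => continuous_apply (γ⁻¹ * δ)

/-- Compact totally disconnected topological `ℤ_p`-modules are pro-`p` groups. -/
theorem isProP_multiplicative (p : ℕ) [Fact p.Prime] (A : Type*) [AddCommGroup A]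
    [TopologicalSpace A] [IsTopologicalAddGroup A] [CompactSpace A] [TotallyDisconnectedSpace A]
    [Module ℤ_[p] A] [ContinuousSMul ℤ_[p] A] : IsProP p (Multiplicative A) where
  compact := inferInstanceAs (CompactSpace A)
  totallyDisconnected := inferInstanceAs (TotallyDisconnectedSpace A)
  isPGroup_quotient V := by
    intro q
    induction q using QuotientGroup.induction_on with
    | H a =>
      have h0 : Filter.Tendsto (fun m : ℕ => (p : ℤ_[p]) ^ m) Filter.atTop (nhds 0) :=
        tendsto_pow_atTop_nhds_zero_of_norm_lt_one ((PadicInt.norm_lt_one_iff_dvd _).2 dvd_rfl)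
      have h1 : Filter.Tendsto (fun m : ℕ => (p : ℤ_[p]) ^ m • a.toAdd) Filter.atTop (nhds 0) := by
        simpa using h0.smul_const a.toAdd
      have hV : IsOpen {b : A | Multiplicative.ofAdd b ∈ V.toSubgroup} := V.isOpen'
      obtain ⟨m, hm⟩ := (h1.eventually (hV.mem_nhds V.toSubgroup.one_mem)).exists
      refine ⟨m, ?_⟩
      rw [← QuotientGroup.mk_pow, QuotientGroup.eq_one_iff]
      have e : (p : ℤ_[p]) ^ m • a.toAdd = (p ^ m) • a.toAdd := by
        rw [← Nat.cast_smul_eq_nsmul ℤ_[p], Nat.cast_pow]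
      rw [e] at hm
      exact hm

/-! ### The universal crossed homomorphism -/

section Universal

variable {p : ℕ} [Fact p.Prime] {Γ : Type*} [Group Γ] [Fintype Γ] {n : ℕ}
  {A : Type*} [AddCommGroup A] [Module ℤ_[p] A] (ρ : Representation ℤ_[p] Γ A)

/-- The `Γ`-equivariant linear map `ℤ_p[Γ]^n → A` sending the `i`-th basis vector to `a i`. -/
noncomputable def extendBasis (a : Fin n → A) : (Γ → Fin n → ℤ_[p]) →ₗ[ℤ_[p]] A where
  toFun m := ∑ i, ∑ γ, m γ i • ρ γ (a i)
  map_add' m m' := by simp [add_smul, Finset.sum_add_distrib]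
  map_smul' c m := by simp [mul_smul, Finset.smul_sum]

theorem extendBasis_apply (a : Fin n → A) (m : Γ → Fin n → ℤ_[p]) :
    extendBasis ρ a m = ∑ i, ∑ γ, m γ i • ρ γ (a i) := rfl

theorem extendBasis_translationRep (a : Fin n → A) (γ : Γ) (m : Γ → Fin n → ℤ_[p]) :
    extendBasis ρ a (translationRep ℤ_[p] Γ _ γ m) = ρ γ (extendBasis ρ a m) := by
  simp only [extendBasis_apply, map_sum, map_smul]
  refine Finset.sum_congr rfl fun i _ => ?_
  refine Fintype.sum_equiv (Equiv.mulLeft γ⁻¹) _ _ fun δ => ?_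
  rw [translationRep_apply, Equiv.coe_mulLeft, ← Module.End.mul_apply, ← map_mul,
    mul_inv_cancel_left]

variable (p Γ) in
/-- The `i`-th basis vector of `ℤ_p[Γ]^n`. -/
noncomputable def basisVec [DecidableEq Γ] (i : Fin n) : Γ → Fin n → ℤ_[p] :=
  Pi.single 1 (Pi.single i 1)

theorem extendBasis_basisVec [DecidableEq Γ] (a : Fin n → A) (i : Fin n) :
    extendBasis ρ a (basisVec p Γ i) = a i := by
  rw [extendBasis_apply, Finset.sum_eq_single i, Finset.sum_eq_single 1]
  · simp [basisVec]
  · intro γ _ hγ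
    simp [basisVec, hγ]
  · simp
  · intro j _ hj
    refine Finset.sum_eq_zero fun γ _ => ?_
    by_cases hγ : γ = 1
    · subst hγ
      simp [basisVec, hj]
    · simp [basisVec, hγ]
  · simp

end Universal

section UniversalCrossedHom

variable {p : ℕ} [Fact p.Prime] {G : Type u} [Group G] [TopologicalSpace G] [IsTopologicalGroup G]
  [IsProP p G] {n : ℕ} {x : Fin n → G} {N : Subgroup G} [N.Normal]
  [DecidableEq (G ⧸ N)]

/-- The Fox derivative: the crossed homomorphism `G → ℤ_p[G/N]^n` sending the free generators to
the basis vectors. -/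
theorem IsFreeProPOn.exists_foxDerivative (hx : IsFreeProPOn p x) (hN : IsOpen (N : Set G)) :
    ∃ D : G → (G ⧸ N) → Fin n → ℤ_[p],
      IsContCrossedHom (translationRep ℤ_[p] (G ⧸ N) (Fin n → ℤ_[p])) D ∧
        ∀ i, D (x i) = basisVec p (G ⧸ N) i :=
  have := isProP_multiplicative p ((G ⧸ N) → Fin n → ℤ_[p])
  hx.exists_crossedHom hN continuous_translationRep _

/-- Every crossed homomorphism factors through the Fox derivative. -/
theorem IsFreeProPOn.extendBasis_foxDerivative [Fintype (G ⧸ N)] (hx : IsFreeProPOn p x)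
    {D : G → (G ⧸ N) → Fin n → ℤ_[p]}
    (hD : IsContCrossedHom (translationRep ℤ_[p] (G ⧸ N) (Fin n → ℤ_[p])) D)
    (hDx : ∀ i, D (x i) = basisVec p (G ⧸ N) i)
    {A : Type u} [AddCommGroup A] [Module ℤ_[p] A] [TopologicalSpace A] [T2Space A]
    [IsTopologicalAddGroup A] (hA : ∀ a : A, Continuous fun z : ℤ_[p] => z • a)
    {ρ : Representation ℤ_[p] (G ⧸ N) A} {d : G → A} (hd : IsContCrossedHom ρ d) (g : G) :
    extendBasis ρ (fun i => d (x i)) (D g) = d g := by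
  have hcont : Continuous (extendBasis ρ fun i => d (x i)) := by
    simp only [funext (extendBasis_apply ρ fun i => d (x i))]
    exact continuous_finsetSum _ fun i _ => continuous_finsetSum _ fun γ _ =>
      (hA _).comp ((continuous_apply i).comp (continuous_apply γ))
  have h : IsContCrossedHom ρ fun g => extendBasis ρ (fun i => d (x i)) (D g) :=
    { continuous := hcont.comp hD.continuous
      map_mul := fun g h => by rw [hD.map_mul, map_add, extendBasis_translationRep] }
  exact congrFun (hx.crossedHom_ext h hd fun i => by rw [hDx, extendBasis_basisVec]) g

end UniversalCrossedHom

/-! ### The transfer -/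

section Transfer

variable {p : ℕ} [Fact p.Prime] {G : Type u} [Group G] (N : Subgroup G) [N.Normal]

/-- For a section `s` of `G → G/N`, the element `g s(δ) s(ḡδ)⁻¹` of `N`. -/
noncomputable def sectionCocycle (g : G) (δ : G ⧸ N) : N :=
  ⟨g * δ.out * ((g : G ⧸ N) * δ).out⁻¹, (QuotientGroup.eq_one_iff _).1 (by simp)⟩

theorem coe_sectionCocycle_mul_out (g : G) (δ : G ⧸ N) :
    (sectionCocycle N g δ : G) * ((g : G ⧸ N) * δ).out = g * δ.out := by
  simp [sectionCocycle]

theorem sectionCocycle_mul (g h : G) (δ : G ⧸ N) :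
    sectionCocycle N (g * h) δ =
      MulAut.conjNormal g (sectionCocycle N h δ) * sectionCocycle N g (h * δ) := by
  ext
  simp [sectionCocycle, mul_assoc]

theorem sectionCocycle_of_mem (m : N) (δ : G ⧸ N) : sectionCocycle N (m : G) δ = m := by
  have : ((m : G) : G ⧸ N) = 1 := (QuotientGroup.eq_one_iff _).2 m.2
  ext
  simp [sectionCocycle, this]

variable [TopologicalSpace G] [IsTopologicalGroup G] [Fintype (G ⧸ N)]

/-- The transfer `g ↦ ∑ δ, g s(δ) s(ḡδ)⁻¹` as a crossed homomorphism `G → N_ab`. -/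
noncomputable def transferAb (g : G) : AbMod N := ∑ δ, AbMod.of (sectionCocycle N g δ)

theorem isContCrossedHom_transferAb [IsProP p N] (hN : IsOpen (N : Set G)) :
    IsContCrossedHom (conjRep p N) (transferAb N) where
  continuous := by
    have : DiscreteTopology (G ⧸ N) := QuotientGroup.discreteTopology hN
    refine continuous_finsetSum _ fun δ _ => AbMod.continuous_of.comp (.subtype_mk ?_ _)
    have h : Continuous fun γ : G ⧸ N => (γ * δ).out⁻¹ := continuous_of_discreteTopology
    exact (continuous_mul_const _).mul (h.comp continuous_quotient_mk')
  map_mul g h := by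
    simp only [transferAb, sectionCocycle_mul, AbMod.of_mul, Finset.sum_add_distrib, map_sum]
    rw [add_comm]
    congr 1
    exact Fintype.sum_equiv (Equiv.mulLeft (h : G ⧸ N)) _ _ fun δ => rfl

/-- On `N` the transfer is multiplication by the index. -/
theorem transferAb_of_mem (m : N) :
    transferAb N (m : G) = Fintype.card (G ⧸ N) • AbMod.of m := by
  simp [transferAb, sectionCocycle_of_mem]

variable {N} in
/-- For a crossed homomorphism `d`, the multiple `|G/N| d` is cohomologous to the composite of the
transfer with the restriction of `d` to `N`; the coboundary comes from `S = ∑ δ, d (s δ)`. -/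
theorem IsContCrossedHom.map_transferAb [IsProP p N] {A : Type u} [AddCommGroup A]
    [Module ℤ_[p] A] [TopologicalSpace A] {ρ : Representation ℤ_[p] (G ⧸ N) A} {d : G → A}
    (hd : IsContCrossedHom ρ d) (l : AbMod N →ₗ[ℤ_[p]] A) (hl : ∀ m : N, l (AbMod.of m) = d m)
    (g : G) :
    l (transferAb N g) = Fintype.card (G ⧸ N) • d g +
      (ρ g (∑ δ : G ⧸ N, d δ.out) - ∑ δ : G ⧸ N, d δ.out) := by
  have key (δ : G ⧸ N) :
      d (sectionCocycle N g δ) = d g + ρ g (d δ.out) - d ((g : G ⧸ N) * δ).out := by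
    rw [eq_sub_iff_add_eq, ← hd.map_mul_of_mem (sectionCocycle N g δ).2,
      coe_sectionCocycle_mul_out, hd.map_mul]
  have hs : ∑ δ : G ⧸ N, d ((g : G ⧸ N) * δ).out = ∑ δ : G ⧸ N, d δ.out :=
    Fintype.sum_equiv (Equiv.mulLeft (g : G ⧸ N)) _ _ fun δ => rfl
  simp only [transferAb, map_sum, hl, key, Finset.sum_sub_distrib, Finset.sum_add_distrib, hs,
    Finset.sum_const, Finset.card_univ]
  abel

end Transfer

/-! ### Splitting the relation sequence -/

section Splitting

variable {k Γ : Type*} [Field k] [Group Γ]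

open MonoidAlgebra

/-- The augmentation of a group algebra. -/
noncomputable def augmentation (k Γ : Type*) [Field k] [Group Γ] : MonoidAlgebra k Γ →ₐ[k] k :=
  MonoidAlgebra.lift k k Γ 1

theorem augmentation_single (γ : Γ) (c : k) : augmentation k Γ (single γ c) = c := by
  simp [augmentation]

variable [Fintype Γ]

variable (k Γ) in
/-- The norm element `∑ γ` of the group algebra. -/
noncomputable def normElement : MonoidAlgebra k Γ := ∑ γ : Γ, single γ 1

theorem augmentation_normElement : augmentation k Γ (normElement k Γ) = Fintype.card Γ := by
  simp [normElement, augmentation_single]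

theorem mul_normElement (a : MonoidAlgebra k Γ) :
    a * normElement k Γ = augmentation k Γ a • normElement k Γ := by
  induction a using MonoidAlgebra.induction_linear with
  | zero => simp
  | add a b ha hb => rw [add_mul, ha, hb, map_add, add_smul]
  | single γ c =>
    rw [augmentation_single, normElement, Finset.mul_sum, Finset.smul_sum]
    refine Fintype.sum_equiv (Equiv.mulLeft γ) _ _ fun δ => ?_
    simp

variable (k Γ) in
/-- The embedding of the trivial representation into the group algebra as the multiples of the
norm element. -/
noncomputable def trivialToMonoidAlgebra :
    (Representation.trivial k Γ k).asModule →ₗ[MonoidAlgebra k Γ] MonoidAlgebra k Γ :=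
  MonoidAlgebra.equivariantOfLinearOfComm
    ((LinearMap.toSpanSingleton k _ (normElement k Γ)).comp
      (Representation.trivial k Γ k).asModuleEquiv.toLinearMap) fun γ c => by
    simp [mul_normElement, augmentation_single]
    rfl

/-- Let `c` be the order of `Γ`. The identities assumed here say that, after division by `c`,
the sequence `0 → V → k[Γ]^ι → k[Γ] → k → 0` with maps `D`, `∂ = bd` and the augmentation is split
exact: `φ` is a retraction of `D`, and `a ↦ -a S` is a section of `∂` on the augmentation ideal.
The inverse of the isomorphism sends `(b, m) ∈ k ⊕ k[Γ]^ι` to `(φ m, ∂ m + b ∑ γ)`. -/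
theorem nonempty_equiv_of_splitting [CharZero k] {ι V : Type*} [AddCommGroup V] [Module k V]
    [Module (MonoidAlgebra k Γ) V] [IsScalarTower k (MonoidAlgebra k Γ) V]
    (D : V →ₗ[MonoidAlgebra k Γ] (ι → MonoidAlgebra k Γ))
    (φ : (ι → MonoidAlgebra k Γ) →ₗ[MonoidAlgebra k Γ] V)
    (bd : (ι → MonoidAlgebra k Γ) →ₗ[MonoidAlgebra k Γ] MonoidAlgebra k Γ)
    (S : ι → MonoidAlgebra k Γ)
    (hφD : ∀ v, φ (D v) = (Fintype.card Γ : k) • v)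
    (hbdD : ∀ v, bd (D v) = 0)
    (hDφ : ∀ m, D (φ m) = (Fintype.card Γ : k) • m + bd m • S)
    (hbdS : bd S = normElement k Γ - algebraMap k _ (Fintype.card Γ : k))
    (haug : ∀ m, augmentation k Γ (bd m) = 0) :
    Nonempty ((V × MonoidAlgebra k Γ) ≃ₗ[MonoidAlgebra k Γ]
      ((Representation.trivial k Γ k).asModule × (ι → MonoidAlgebra k Γ))) := by
  have hc : (Fintype.card Γ : k) ≠ 0 := Nat.cast_ne_zero.2 Fintype.card_ne_zero
  set c : k := (Fintype.card Γ : k)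
  let τ := (Representation.trivial k Γ k).asModuleEquiv
  let F : ((Representation.trivial k Γ k).asModule × (ι → MonoidAlgebra k Γ))
      →ₗ[MonoidAlgebra k Γ] V × MonoidAlgebra k Γ :=
    (φ.comp (LinearMap.snd _ _ _)).prod
      ((trivialToMonoidAlgebra k Γ).coprod bd)
  have hF (b : k) (m : ι → MonoidAlgebra k Γ) :
      F (τ.symm b, m) = (φ m, b • normElement k Γ + bd m) := rfl
  refine ⟨(LinearEquiv.ofBijective F ⟨?_, ?_⟩).symm⟩
  · rw [← LinearMap.ker_eq_bot, LinearMap.ker_eq_bot']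
    rintro ⟨b, m⟩ h
    obtain ⟨b, rfl⟩ := τ.symm.surjective b
    rw [hF, Prod.mk_eq_zero] at h
    obtain ⟨h1, h2⟩ := h
    have hb : b = 0 := by
      have := congrArg (augmentation k Γ) h2
      rw [map_add, haug, map_smul, augmentation_normElement, map_zero, add_zero,
        smul_eq_mul] at this
      exact (mul_eq_zero.1 this).resolve_right hc
    rw [hb, zero_smul, zero_add] at h2
    have := hDφ m
    rw [h1, h2, map_zero, zero_smul, add_zero] at this
    rw [hb, (smul_eq_zero.1 this.symm).resolve_left hc, map_zero]
    rfl
  · rintro ⟨v, a⟩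
    -- `φ S` need not vanish, whence the correction term in the preimage
    refine ⟨(τ.symm (c⁻¹ * augmentation k Γ a),
      c⁻¹ • (D (v + c⁻¹ • (a • φ S)) - a • S)), ?_⟩
    rw [hF, Prod.mk.injEq]
    constructor
    · rw [LinearMap.map_smul_of_tower, map_sub, hφD, map_smul, smul_sub, smul_smul,
        inv_mul_cancel₀ hc, one_smul, add_sub_cancel_right]
    · rw [LinearMap.map_smul_of_tower, map_sub, hbdD, map_smul, hbdS, zero_sub, smul_eq_mul,
        mul_sub, mul_normElement, neg_sub, ← Algebra.commutes, ← Algebra.smul_def, smul_sub,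
        smul_smul, smul_smul, inv_mul_cancel₀ hc, one_smul]
      abel

end Splitting

/-! ### Rational coefficients -/

section Rational

open MonoidAlgebra

variable {p : ℕ} [Fact p.Prime] {Γ : Type*} [Fintype Γ] {n : ℕ}

variable (p Γ) in
/-- The inclusion `ℤ_p[Γ] → ℚ_p[Γ]`, the source being encoded as functions on `Γ`. -/
noncomputable def toRational : (Γ → ℤ_[p]) →ₗ[ℤ_[p]] MonoidAlgebra ℚ_[p] Γ where
  toFun f := ∑ γ, single γ (f γ : ℚ_[p])
  map_add' f f' := by simp [single_add, Finset.sum_add_distrib]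
  map_smul' c f := by
    simp only [Finset.smul_sum, smul_single]
    rfl

theorem toRational_apply (f : Γ → ℤ_[p]) :
    toRational p Γ f = ∑ γ, single γ (f γ : ℚ_[p]) := rfl

theorem toRational_single [DecidableEq Γ] (γ : Γ) :
    toRational p Γ (Pi.single γ 1) = single γ 1 := by
  rw [toRational_apply, Finset.sum_eq_single γ]
  · simp
  · intro δ _ hδ
    simp [hδ]
  · simp

variable (p Γ n) in
/-- The inclusion `ℤ_p[Γ]^n → ℚ_p[Γ]^n`. -/
noncomputable def toRationalPi :
    (Γ → Fin n → ℤ_[p]) →ₗ[ℤ_[p]] (Fin n → MonoidAlgebra ℚ_[p] Γ) where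
  toFun m i := toRational p Γ fun γ => m γ i
  map_add' m m' := funext fun i => map_add (toRational p Γ) (fun γ => m γ i) fun γ => m' γ i
  map_smul' c m := funext fun i => map_smul (toRational p Γ) c fun γ => m γ i

theorem toRationalPi_apply (m : Γ → Fin n → ℤ_[p]) (i : Fin n) :
    toRationalPi p Γ n m i = toRational p Γ fun γ => m γ i := rfl

variable [Group Γ]

theorem toRational_translationRep (γ : Γ) (f : Γ → ℤ_[p]) :
    toRational p Γ (translationRep ℤ_[p] Γ _ γ f) = single γ 1 * toRational p Γ f := by
  rw [toRational_apply, toRational_apply, Finset.mul_sum]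
  refine Fintype.sum_equiv (Equiv.mulLeft γ⁻¹) _ _ fun δ => ?_
  simp [translationRep_apply]

theorem toRationalPi_translationRep (γ : Γ) (m : Γ → Fin n → ℤ_[p]) :
    toRationalPi p Γ n (translationRep ℤ_[p] Γ _ γ m) =
      (single γ 1 : MonoidAlgebra ℚ_[p] Γ) • toRationalPi p Γ n m :=
  funext fun i => toRational_translationRep γ fun δ => m δ i

theorem toRationalPi_basisVec [DecidableEq Γ] (i : Fin n) :
    toRationalPi p Γ n (basisVec p Γ i) = Pi.single i 1 := by
  funext j
  rw [toRationalPi_apply]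
  by_cases h : j = i
  · subst h
    rw [Pi.single_eq_same, MonoidAlgebra.one_def, ← toRational_single]
    congr 1
    funext γ
    by_cases hγ : γ = 1
    · subst hγ
      simp [basisVec]
    · simp [basisVec, hγ]
  · rw [Pi.single_eq_of_ne h, ← map_zero (toRational p Γ)]
    congr 1
    funext γ
    by_cases hγ : γ = 1
    · subst hγ
      simp [basisVec, h]
    · simp [basisVec, hγ]

/-- The `ℤ_p[Γ]`-linear map with prescribed values on the basis is compatible with the
`ℚ_p[Γ]`-linear one. -/
theorem linearCombination_toRationalPi {A : Type*} [AddCommGroup A] [Module ℤ_[p] A]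
    (ρ : Representation ℤ_[p] Γ A) {W : Type*} [AddCommGroup W] [Module ℚ_[p] W]
    [Module (MonoidAlgebra ℚ_[p] Γ) W] [IsScalarTower ℚ_[p] (MonoidAlgebra ℚ_[p] Γ) W]
    (j : A →+ W) (hjs : ∀ (z : ℤ_[p]) a, j (z • a) = (z : ℚ_[p]) • j a)
    (hj : ∀ γ a, j (ρ γ a) = (single γ 1 : MonoidAlgebra ℚ_[p] Γ) • j a)
    (a : Fin n → A) (m : Γ → Fin n → ℤ_[p]) :
    Fintype.linearCombination (MonoidAlgebra ℚ_[p] Γ) (fun i => j (a i)) (toRationalPi p Γ n m) =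
      j (extendBasis ρ a m) := by
  rw [Fintype.linearCombination_apply, extendBasis_apply, map_sum]
  refine Finset.sum_congr rfl fun i _ => ?_
  rw [toRationalPi_apply, toRational_apply, Finset.sum_smul, map_sum]
  refine Finset.sum_congr rfl fun γ _ => ?_
  have h : (single γ (m γ i : ℚ_[p]) : MonoidAlgebra ℚ_[p] Γ) = (m γ i : ℚ_[p]) • single γ 1 := by
    simp
  rw [hjs, hj, h, smul_assoc]

end Rational

/-! ### The relation sequence -/

section RelationSequence

open MonoidAlgebra

variable {p : ℕ} [Fact p.Prime] {G : Type u} [Group G] [TopologicalSpace G] [IsTopologicalGroup G]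
  {N : Subgroup G} [N.Normal]

variable (p N) in
/-- The canonical map `N_ab → N_ab ⊗ ℚ_p`. -/
noncomputable def toRationalAb [IsProP p N] :
    AbMod N →ₗ[ℤ_[p]] ℚ_[p] ⊗[ℤ_[p]] AbMod N :=
  TensorProduct.mk ℤ_[p] ℚ_[p] (AbMod N) 1

/-- The crossed homomorphism `g ↦ ḡ - 1` with values in `ℤ_p[G/N]`. -/
theorem isContCrossedHom_single_sub_one [DecidableEq (G ⧸ N)] (hN : IsOpen (N : Set G)) :
    IsContCrossedHom (translationRep ℤ_[p] (G ⧸ N) ℤ_[p])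
      fun g => Pi.single (g : G ⧸ N) 1 - Pi.single 1 1 where
  continuous := by
    have : DiscreteTopology (G ⧸ N) := QuotientGroup.discreteTopology hN
    have h : Continuous fun γ : G ⧸ N => (Pi.single γ 1 - Pi.single 1 1 : (G ⧸ N) → ℤ_[p]) :=
      continuous_of_discreteTopology
    exact h.comp continuous_quotient_mk'
  map_mul g h := by
    have key (δ : G ⧸ N) : translationRep ℤ_[p] (G ⧸ N) ℤ_[p] g (Pi.single δ 1) =
        Pi.single (g * δ) 1 := by
      funext ε
      simp [translationRep_apply, Pi.single_apply, inv_mul_eq_iff_eq_mul]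
    rw [map_sub, key, key, mul_one, QuotientGroup.mk_mul]
    abel

theorem rationalConjRep_single_smul [IsProP p N] (γ : G ⧸ N) (a : AbMod N) :
    (rationalConjRep p N).asModuleEquiv.symm (toRationalAb p N (conjRep p N γ a)) =
      (single γ 1 : MonoidAlgebra ℚ_[p] (G ⧸ N)) •
        (rationalConjRep p N).asModuleEquiv.symm (toRationalAb p N a) := by
  rw [Representation.single_smul, one_smul]
  rfl

/-- The isomorphism for a group that is free on `n` given elements `x`, obtained by checking the
identities of `nonempty_equiv_of_splitting` for the rational extension of the Fox derivative
restricted to `N`, the map `φ` given by the values of the transfer on `x`, the boundary map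
`eᵢ ↦ x̄ᵢ - 1`, and `S` the sum of the Fox derivatives of representatives of `G/N`. -/
theorem IsFreeProPOn.nonempty_equiv [IsProP p G] [IsProP p N] {n : ℕ} {x : Fin n → G}
    (hx : IsFreeProPOn p x) (hN : IsOpen (N : Set G)) :
    Nonempty (((rationalConjRep p N).asModule × MonoidAlgebra ℚ_[p] (G ⧸ N))
      ≃ₗ[MonoidAlgebra ℚ_[p] (G ⧸ N)]
      ((Representation.trivial ℚ_[p] (G ⧸ N) ℚ_[p]).asModule ×
        (Fin n → MonoidAlgebra ℚ_[p] (G ⧸ N)))) := by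
  classical
  have : CompactSpace G := IsProP.compact p
  have : Finite (G ⧸ N) := Subgroup.quotient_finite_of_isOpen N hN
  have : Fintype (G ⧸ N) := Fintype.ofFinite _
  obtain ⟨D, hD, hDx⟩ := hx.exists_foxDerivative hN
  obtain ⟨l, hl⟩ := AbMod.exists_lift (p := p) (fun m : N => D m)
    (hD.continuous.comp continuous_subtype_val) fun g h => hD.map_mul_of_mem g.2 h
  have hlρ (γ : G ⧸ N) (a : AbMod N) :
      l (conjRep p N γ a) = translationRep ℤ_[p] (G ⧸ N) _ γ (l a) := by
    induction γ using QuotientGroup.induction_on with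
    | H g =>
      obtain ⟨m, rfl⟩ := AbMod.of_surjective a
      rw [conjRep_apply, hl, hl, MulAut.conjNormal_apply, hD.map_conj m.2]
  let R := MonoidAlgebra ℚ_[p] (G ⧸ N)
  let V := (rationalConjRep p N).asModule
  let τ := (rationalConjRep p N).asModuleEquiv
  let ι := toRationalPi p (G ⧸ N) n
  let j : AbMod N →+ V := (toRationalAb p N).toAddMonoidHom
  have hjs (z : ℤ_[p]) (a : AbMod N) : j (z • a) = (z : ℚ_[p]) • j a :=
    (map_smul (toRationalAb p N) z a).trans (algebraMap_smul ℚ_[p] z (toRationalAb p N a)).symm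
  -- the integral crossed homomorphisms `t` and `d` and their rational extensions `φ` and `∂`
  let t := transferAb N
  have ht : IsContCrossedHom (conjRep p N) t := isContCrossedHom_transferAb N hN
  let d : G → (G ⧸ N) → ℤ_[p] := fun g => Pi.single (g : G ⧸ N) 1 - Pi.single 1 1
  have hd : IsContCrossedHom (translationRep ℤ_[p] (G ⧸ N) ℤ_[p]) d :=
    isContCrossedHom_single_sub_one hN
  let φ : (Fin n → R) →ₗ[R] V := Fintype.linearCombination R fun i => j (t (x i))
  let bd : (Fin n → R) →ₗ[R] R :=
    Fintype.linearCombination R fun i => toRational p (G ⧸ N) (d (x i))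
  have hφ (g : G) : φ (ι (D g)) = j (t g) := by
    refine (linearCombination_toRationalPi (conjRep p N) j hjs
      rationalConjRep_single_smul _ _).trans (congrArg j ?_)
    exact hx.extendBasis_foxDerivative hD hDx AbMod.continuous_smul_const ht g
  have hdr (g : G) : toRational p (G ⧸ N) (d g) = single (g : G ⧸ N) 1 - 1 := by
    rw [map_sub, toRational_single, toRational_single]
    rfl
  have hbd (g : G) : bd (ι (D g)) = single (g : G ⧸ N) 1 - 1 := by
    refine (linearCombination_toRationalPi (translationRep ℤ_[p] (G ⧸ N) ℤ_[p])
      (toRational p (G ⧸ N)).toAddMonoidHom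
      (fun z a => (map_smul (toRational p (G ⧸ N)) z a).trans (algebraMap_smul ℚ_[p] z _).symm)
      toRational_translationRep _ _).trans (Eq.trans ?_ (hdr g))
    refine congrArg (toRational p (G ⧸ N)) ?_
    exact hx.extendBasis_foxDerivative hD hDx
      (fun a => continuous_id.smul continuous_const) hd g
  -- the rational extension of the restriction of the Fox derivative to `N`
  let D₀ : (ℚ_[p] ⊗[ℤ_[p]] AbMod N) →ₗ[ℚ_[p]] (Fin n → R) := (ι ∘ₗ l).liftBaseChange ℚ_[p]
  have hD₀ (q : ℚ_[p]) (a : AbMod N) : D₀ (q ⊗ₜ a) = q • ι (l a) := by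
    simp [D₀]
  let DQ : V →ₗ[R] (Fin n → R) :=
    MonoidAlgebra.equivariantOfLinearOfComm (D₀ ∘ₗ τ.toLinearMap) fun γ v => by
      rw [Representation.single_smul, one_smul]
      change D₀ (rationalConjRep p N γ (τ v)) = single γ (1 : ℚ_[p]) • D₀ (τ v)
      induction τ v using TensorProduct.induction_on with
      | zero => simp
      | add a b ha hb => rw [map_add, map_add, ha, hb, map_add, smul_add]
      | tmul q a =>
        rw [rationalConjRep_tmul, hD₀, hD₀, hlρ, toRationalPi_translationRep, smul_comm]
  have hDQ (a : AbMod N) : DQ (j a) = ι (l a) := (hD₀ 1 a).trans (one_smul _ _)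
  -- identities of `ℚ_p`-linear maps on `V` may be checked on the image of `N`
  have hext {W : Type u} [AddCommGroup W] [Module ℚ_[p] W] (f f' : V →ₗ[ℚ_[p]] W)
      (h : ∀ m : N, f (j (AbMod.of m)) = f' (j (AbMod.of m))) : f = f' := by
    refine LinearMap.ext fun v => TensorProduct.induction_on
      (motive := fun w => f (τ.symm w) = f' (τ.symm w)) (τ v) ?_ (fun q a => ?_) fun a b ha hb => ?_
    · simp
    · obtain ⟨m, rfl⟩ := AbMod.of_surjective a
      have e : q ⊗ₜ[ℤ_[p]] AbMod.of m = q • toRationalAb p N (AbMod.of m) := by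
        rw [toRationalAb, TensorProduct.mk_apply, TensorProduct.smul_tmul', smul_eq_mul, mul_one]
      rw [e, map_smul, map_smul, map_smul]
      exact congrArg (q • ·) (h m)
    · rw [map_add, map_add, map_add, ha, hb]
  let S₀ : (G ⧸ N) → Fin n → ℤ_[p] := ∑ δ : G ⧸ N, D δ.out
  refine nonempty_equiv_of_splitting DQ φ bd (ι S₀) (fun v => ?_) (fun v => ?_) (fun m => ?_) ?_
    fun m => ?_
  · refine LinearMap.congr_fun (f := (φ.comp DQ).restrictScalars ℚ_[p])
      (g := (Fintype.card (G ⧸ N) : ℚ_[p]) • LinearMap.id) (hext _ _ fun m => ?_) v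
    change φ (DQ (j (AbMod.of m))) = (Fintype.card (G ⧸ N) : ℚ_[p]) • j (AbMod.of m)
    rw [hDQ, hl, hφ, Nat.cast_smul_eq_nsmul, ← map_nsmul]
    exact congrArg j (transferAb_of_mem N m)
  · refine LinearMap.congr_fun (f := (bd.comp DQ).restrictScalars ℚ_[p]) (g := 0)
      (hext _ _ fun m => ?_) v
    change bd (DQ (j (AbMod.of m))) = 0
    rw [hDQ, hl, hbd, (QuotientGroup.eq_one_iff (m : G)).2 m.2, ← MonoidAlgebra.one_def, sub_self]
  · -- both sides are `ℚ_p[G/N]`-linear in `m`, so it suffices to treat the basis vectors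
    have h : DQ.comp φ = (Fintype.card (G ⧸ N)) • LinearMap.id + bd.smulRight (ι S₀) := by
      refine LinearMap.pi_ext' fun i => LinearMap.ext_ring ?_
      change DQ (φ (Pi.single i 1)) =
        Fintype.card (G ⧸ N) • Pi.single i 1 + bd (Pi.single i 1) • ι S₀
      rw [← toRationalPi_basisVec, ← hDx]
      change DQ (φ (ι (D (x i)))) = Fintype.card (G ⧸ N) • ι (D (x i)) + bd (ι (D (x i))) • ι S₀
      rw [hφ, hDQ, hbd, hD.map_transferAb l hl, map_add, map_sub, map_nsmul,
        toRationalPi_translationRep, sub_smul, one_smul]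
    rw [Nat.cast_smul_eq_nsmul]
    exact LinearMap.congr_fun h m
  · rw [map_sum, map_sum]
    simp only [hbd, QuotientGroup.out_eq', Finset.sum_sub_distrib, normElement]
    simp
  · change augmentation _ _ (∑ i, m i • toRational p (G ⧸ N) (d (x i))) = 0
    rw [map_sum]
    refine Finset.sum_eq_zero fun i _ => ?_
    rw [hdr, smul_eq_mul, map_mul, map_sub, augmentation_single, map_one, sub_self, mul_zero]

end RelationSequence

theorem mainTheorem8 (p : ℕ) [Fact p.Prime] {G : Type u} [Group G] [TopologicalSpace G]
    [IsTopologicalGroup G] [IsProP p G] (hG : ∃ (n : ℕ) (x : Fin n → G), IsFreeProPOn p x)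
    (N : OpenNormalSubgroup G) :
    Nonempty
      (((rationalConjRep p N.toSubgroup).asModule × MonoidAlgebra ℚ_[p] (G ⧸ N.toSubgroup))
        ≃ₗ[MonoidAlgebra ℚ_[p] (G ⧸ N.toSubgroup)]
      ((Representation.trivial ℚ_[p] (G ⧸ N.toSubgroup) ℚ_[p]).asModule ×
        (Fin (genRank p G) → MonoidAlgebra ℚ_[p] (G ⧸ N.toSubgroup)))) := by
  obtain ⟨n, x, hx⟩ := hG
  rw [hx.genRank_eq]
  exact hx.nonempty_equiv N.isOpen'
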